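/- For a finite simple graph $G$, let $c(G)$ be its cop number (the least number of cops that can always capture the robber in the game of Cops and Robbers on $G$, where in each turn every piece moves to an adjacent vertex or stays where it is), let $\theta(G)$ be its clique cover number (the least number of cliques covering all vertices of $G$), and let $\alpha(G)$ be its independence number. For every positive integer $k$ there is a connected finite simple graph $G$ with at most $\max\{1,\, 11(\log k)^2k^4\}$ vertices such that $c(G)=\theta(G)=\alpha(G)=k$, where $\log$ is the natural logarithm. (For $k\ge 2$ the bound on the number of vertices is $11(\log k)^2k^4$.) In particular, for every $k\ge 3$ there is a connected graph $G$ with $c(G)=\alpha(G)=k$, so that the inequality $c(G)<\alpha(G)$ does not hold for all connected graphs with $\alpha(G)=k$; this answers Turcotte's question in the negative for every value of $\alpha$. -/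

import Mathlib

namespace SimpleGraph

/-- In one turn a piece on `u` may pass or move along an edge; `G.IsMove u v` says that it may
end the turn on `v`. -/
def IsMove {V : Type*} (G : SimpleGraph V) (u v : V) : Prop :=
  v = u ∨ G.Adj u v

/-- A strategy for `n` cops on `G`, with perfect information and perfect recall.  The argument of
`pos` is the list of all positions that the robber has occupied so far, latest first, and the value
is the placement of the cops in response to it: `pos []` is the initial placement, chosen before
the robber is placed, and `pos (v :: h)` is the placement after the cops have answered the robber's
arrival on `v`.  (The earlier placements of the cops are determined by the robber's positions.) -/
structure CopStrategy {V : Type*} (G : SimpleGraph V) (n : ℕ) where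
  pos : List V → Fin n → V
  isMove : ∀ (h : List V) (v : V) (i : Fin n), G.IsMove (pos h i) (pos (v :: h) i)

/-- The list `[r (t - 1), …, r 1, r 0]` of the first `t` positions of the robber, latest first. -/
def robberHistory {V : Type*} (r : ℕ → V) : ℕ → List V
  | 0 => []
  | t + 1 => r t :: robberHistory r t

/-- A play of the robber: he is placed on `r 0`, and `r (t + 1)` is his position after his
`(t + 1)`-st move.  As `r` is arbitrary, he may react to the cops in any way. -/
def IsRobberPlay {V : Type*} (G : SimpleGraph V) (r : ℕ → V) : Prop :=
  ∀ t, G.IsMove (r t) (r (t + 1))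

/-- The strategy `S` captures the robber who plays `r`: after finitely many moves a cop and the
robber are on the same vertex, either just after the robber's turn or just after the cops'
answer to it. -/
def CopStrategy.Captures {V : Type*} {G : SimpleGraph V} {n : ℕ} (S : G.CopStrategy n)
    (r : ℕ → V) : Prop :=
  ∃ (t : ℕ) (i : Fin n),
    S.pos (robberHistory r t) i = r t ∨ S.pos (robberHistory r (t + 1)) i = r t

/-- `n` cops win on `G`: some strategy of theirs captures the robber however he plays. -/
def CopsWin {V : Type*} (G : SimpleGraph V) (n : ℕ) : Prop :=
  ∃ S : G.CopStrategy n, ∀ r : ℕ → V, G.IsRobberPlay r → S.Captures r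

/-- The cop number `c(G)`: the least number of cops that win on `G` (`⊤` if there is none). -/
noncomputable def copNumber {V : Type*} (G : SimpleGraph V) : ℕ∞ :=
  ⨅ (n : ℕ) (_ : G.CopsWin n), (n : ℕ∞)

/-- The vertices of `G` can be covered by `n` cliques. -/
def HasCliqueCover {V : Type*} (G : SimpleGraph V) (n : ℕ) : Prop :=
  ∃ K : Fin n → Set V, (∀ i, G.IsClique (K i)) ∧ ∀ v, ∃ i, v ∈ K i

/-- The clique cover number `θ(G)`: the least number of cliques that cover the vertices of `G`
(`⊤` if there is none). -/
noncomputable def cliqueCoverNumber {V : Type*} (G : SimpleGraph V) : ℕ∞ :=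
  ⨅ (n : ℕ) (_ : G.HasCliqueCover n), (n : ℕ∞)

end SimpleGraph

/-! Take `k` cliques, each a copy of `F³` with `|F| ≥ k`, joined so that a vertex sees a line of
`|F|` points in every other clique, and distinct vertices outside a clique see at most one common
point in it. Fewer than `k` cops leave some clique empty. A robber outside it has `|F|` ways in and
each cop guards at most one; a robber inside it finds a safe point there. So he escapes forever. One
cop per clique wins, and an independent transversal gives `α = θ = k`. -/

namespace SimpleGraph

section General

variable {V : Type*} {G : SimpleGraph V}

/-- If the robber can always move to a vertex out of reach of `n` cops, then `n` cops do not
win. -/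
theorem not_copsWin_of_escape {n : ℕ}
    (hinit : ∀ C : Fin n → V, ∃ u, ∀ i, ¬ G.IsMove (C i) u)
    (hstep : ∀ (C : Fin n → V) (v : V), (∀ i, C i ≠ v) →
      ∃ u, G.IsMove v u ∧ ∀ i, ¬ G.IsMove (C i) u) :
    ¬ G.CopsWin n := by
  classical
  rintro ⟨S, hS⟩
  choose a ha using hinit
  choose b hb using hstep
  let f : List V → V := fun h => match h with
    | [] => a (S.pos [])
    -- The `else` value is a dummy: `safe` shows that this robber is never caught.
    | v :: h => if hv : ∀ i, S.pos (v :: h) i ≠ v then b (S.pos (v :: h)) v hv else v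
  let hist : ℕ → List V := fun t => Nat.rec [] (fun _ h => f h :: h) t
  let r : ℕ → V := fun t => f (hist t)
  have hist_eq : ∀ t, robberHistory r t = hist t := by
    intro t
    induction t with
    | zero => rfl
    | succ t ih => rw [robberHistory, ih]
  have avoid_of_safe : ∀ t, (∀ i, ¬ G.IsMove (S.pos (hist t) i) (r t)) →
      ∀ i, S.pos (hist (t + 1)) i ≠ r t := by
    intro t ht i heq
    have hm := S.isMove (hist t) (r t) i
    exact ht i (heq ▸ hm)
  have next_eq : ∀ t (h : ∀ i, S.pos (hist (t + 1)) i ≠ r t),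
      r (t + 1) = b (S.pos (hist (t + 1))) (r t) h := fun t h => dif_pos h
  have safe : ∀ t i, ¬ G.IsMove (S.pos (hist t) i) (r t) := by
    intro t
    induction t with
    | zero => exact ha (S.pos [])
    | succ t ih =>
      rw [next_eq t (avoid_of_safe t ih)]
      exact (hb _ _ (avoid_of_safe t ih)).2
  have play : G.IsRobberPlay r := by
    intro t
    rw [next_eq t (avoid_of_safe t (safe t))]
    exact (hb _ _ (avoid_of_safe t (safe t))).1
  obtain ⟨t, i, h | h⟩ := hS r play
  · rw [hist_eq] at h
    exact safe t i (Or.inl h.symm)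
  · rw [hist_eq] at h
    exact avoid_of_safe t (safe t) i h

/-- A cop waiting in each nonempty clique captures the robber in the first answer. -/
theorem HasCliqueCover.copsWin [Nonempty V] {n : ℕ} (h : G.HasCliqueCover n) :
    G.CopsWin n := by
  classical
  obtain ⟨K, hK, hcover⟩ := h
  have hrep : ∀ i, ∃ x, ∀ v ∈ K i, G.IsMove x v := by
    intro i
    by_cases hi : (K i).Nonempty
    · obtain ⟨x, hx⟩ := hi
      refine ⟨x, fun v hv => ?_⟩
      by_cases hxv : v = x
      · exact Or.inl hxv
      · exact Or.inr (hK i hx hv (Ne.symm hxv))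
    · exact ⟨Classical.arbitrary V, fun v hv => (hi ⟨v, hv⟩).elim⟩
  choose x hx using hrep
  let pos : List V → Fin n → V := fun h i =>
    h.foldr (fun v p => if G.IsMove p v then v else p) (x i)
  refine ⟨⟨pos, fun h v i => ?_⟩, fun r _ => ?_⟩
  · change G.IsMove (pos h i) (if G.IsMove (pos h i) v then v else pos h i)
    split_ifs with hm
    · exact hm
    · exact Or.inl rfl
  · obtain ⟨i, hi⟩ := hcover (r 0)
    exact ⟨0, i, Or.inr (if_pos (hx i _ hi))⟩

theorem HasCliqueCover.card_le_of_isIndepSet {n : ℕ} (h : G.HasCliqueCover n) {s : Finset V}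
    (hs : G.IsIndepSet s) : s.card ≤ n := by
  obtain ⟨K, hK, hcover⟩ := h
  choose f hf using hcover
  have hinj : Set.InjOn f s := by
    intro u hu v hv huv
    by_contra hne
    exact hs hu hv hne (hK (f u) (hf u) (huv ▸ hf v) hne)
  simpa using Finset.card_le_card_of_injOn f (fun _ _ => Finset.mem_univ _) hinj

theorem copNumber_eq_of_copsWin {k : ℕ} (hk : G.CopsWin k) (h : ∀ n < k, ¬ G.CopsWin n) :
    G.copNumber = k := by
  refine le_antisymm (iInf₂_le k hk) (le_iInf₂ fun n hn => ?_)
  exact_mod_cast not_lt.mp fun hlt => h n hlt hn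

theorem cliqueCoverNumber_eq_of_isIndepSet {k : ℕ} (hk : G.HasCliqueCover k) {s : Finset V}
    (hs : G.IsIndepSet s) (hcard : s.card = k) : G.cliqueCoverNumber = k := by
  refine le_antisymm (iInf₂_le k hk) (le_iInf₂ fun n hn => ?_)
  exact_mod_cast hcard ▸ hn.card_le_of_isIndepSet hs

theorem indepNum_eq_of_hasCliqueCover [Fintype V] {k : ℕ} (hk : G.HasCliqueCover k)
    {s : Finset V} (hs : G.IsIndepSet s) (hcard : s.card = k) : G.indepNum = k := by
  refine le_antisymm ?_ (hcard ▸ hs.card_le_indepNum)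
  obtain ⟨t, ht⟩ := G.exists_isNIndepSet_indepNum
  exact ht.card_eq ▸ hk.card_le_of_isIndepSet ht.isIndepSet

end General

theorem exists_forall_not_of_card_lt {α β : Type*} [Fintype α] [Fintype β]
    (hcard : Fintype.card α < Fintype.card β) (P : α → β → Prop)
    (hP : ∀ i s t, P i s → P i t → s = t) : ∃ t, ∀ i, ¬ P i t := by
  by_contra! h
  choose f hf using h
  have hinj : Function.Injective f := fun s t hst => hP (f s) s t (hf s) (hst ▸ hf t)
  exact absurd (Fintype.card_le_of_injective f hinj) (not_le.mpr hcard)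

section Construction

variable {ι F : Type*} [Field F]

/-- The graph on `ι × F³` whose fibres over `ι` are cliques and in which `(i, x)` and `(j, y)`,
for `i ≠ j`, are adjacent when `x₂ + y₂ = x₁ y₁` and `x₃ + y₃ = (c i + c j) (x₁ + y₁)`.  The
vertices of a fibre adjacent to a given vertex outside it form a line in `F³`. -/
def lineGraphOfCliques (c : ι → F) : SimpleGraph (ι × F × F × F) where
  Adj u v := u ≠ v ∧ (u.1 = v.1 ∨ (u.2.2.1 + v.2.2.1 = u.2.1 * v.2.1 ∧
    u.2.2.2 + v.2.2.2 = (c u.1 + c v.1) * (u.2.1 + v.2.1)))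
  symm := ⟨by
    rintro u v ⟨hne, h | ⟨h₁, h₂⟩⟩
    · exact ⟨hne.symm, Or.inl h.symm⟩
    · exact ⟨hne.symm, Or.inr ⟨by rw [add_comm, h₁, mul_comm], by
        rw [add_comm, h₂, add_comm (c u.1), add_comm u.2.1]⟩⟩⟩
  loopless := ⟨fun _ h => h.1 rfl⟩

variable {c : ι → F}

theorem lineGraphOfCliques_isMove_of_fst_eq {u v : ι × F × F × F} (h : u.1 = v.1) :
    (lineGraphOfCliques c).IsMove u v := by
  by_cases huv : v = u
  · exact Or.inl huv
  · exact Or.inr ⟨Ne.symm huv, Or.inl h⟩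

theorem lineGraphOfCliques_isMove_iff {u v : ι × F × F × F} (h : u.1 ≠ v.1) :
    (lineGraphOfCliques c).IsMove u v ↔ u.2.2.1 + v.2.2.1 = u.2.1 * v.2.1 ∧
      u.2.2.2 + v.2.2.2 = (c u.1 + c v.1) * (u.2.1 + v.2.1) := by
  have hne : u ≠ v := fun huv => h (congrArg Prod.fst huv)
  constructor
  · rintro (h' | ⟨-, h' | h'⟩)
    · exact (hne h'.symm).elim
    · exact (h h').elim
    · exact h'
  · exact fun h' => Or.inr ⟨hne, Or.inr h'⟩

/-- The vertex with first coordinate `t` on the line of neighbours of `v` in the fibre over `j`. -/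
def lineGraphOfCliquesNeighbor (c : ι → F) (v : ι × F × F × F) (j : ι) (t : F) :
    ι × F × F × F :=
  (j, t, v.2.1 * t - v.2.2.1, (c v.1 + c j) * (v.2.1 + t) - v.2.2.2)

theorem lineGraphOfCliques_isMove_neighbor {v : ι × F × F × F} {j : ι} (h : v.1 ≠ j) (t : F) :
    (lineGraphOfCliques c).IsMove v (lineGraphOfCliquesNeighbor c v j t) := by
  rw [lineGraphOfCliques_isMove_iff h]
  simp [lineGraphOfCliquesNeighbor]

theorem lineGraphOfCliques_connected [Nonempty ι] : (lineGraphOfCliques c).Connected := by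
  have reachable_of_isMove : ∀ {u v}, (lineGraphOfCliques c).IsMove u v →
      (lineGraphOfCliques c).Reachable u v := by
    rintro u v (rfl | h)
    · exact Reachable.refl _
    · exact h.reachable
  refine ⟨fun u v => ?_⟩
  by_cases h : u.1 = v.1
  · exact reachable_of_isMove (lineGraphOfCliques_isMove_of_fst_eq h)
  · exact (reachable_of_isMove (lineGraphOfCliques_isMove_neighbor h 0)).trans
      (reachable_of_isMove (lineGraphOfCliques_isMove_of_fst_eq rfl))

/-- Distinct vertices outside a fibre have at most one common neighbour in it. -/
theorem lineGraphOfCliques_eq_of_isMove_neighbor (hc : Function.Injective c)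
    {u v : ι × F × F × F} {j : ι} (huj : u.1 ≠ j) (huv : u ≠ v) {s t : F}
    (hs : (lineGraphOfCliques c).IsMove u (lineGraphOfCliquesNeighbor c v j s))
    (ht : (lineGraphOfCliques c).IsMove u (lineGraphOfCliquesNeighbor c v j t)) : s = t := by
  rw [lineGraphOfCliques_isMove_iff huj] at hs ht
  obtain ⟨i, x₁, x₂, x₃⟩ := u
  obtain ⟨i', y₁, y₂, y₃⟩ := v
  simp only [lineGraphOfCliquesNeighbor] at hs ht huj
  obtain ⟨hs₁, hs₂⟩ := hs
  obtain ⟨ht₁, ht₂⟩ := ht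
  by_contra hst
  have hst' : s - t ≠ 0 := sub_ne_zero.mpr hst
  -- Two common points force equal directions `(1, y₁, c i' + c j)`, which give `y₁` and, as `c` is
  -- injective, the fibre; the offsets then give the rest.
  have h₁ : x₁ = y₁ := mul_right_cancel₀ hst' (by linear_combination ht₁ - hs₁)
  have hci : c i = c i' := mul_right_cancel₀ hst' (by linear_combination ht₂ - hs₂)
  have hi : i = i' := hc hci
  subst h₁ hi
  have h₂ : x₂ = y₂ := by linear_combination hs₁
  have h₃ : x₃ = y₃ := by linear_combination hs₂
  exact huv (by rw [h₂, h₃])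

theorem lineGraphOfCliques_exists_not_isMove [Fintype F] {n : ℕ} (hn : n < Fintype.card F)
    (C : Fin n → ι × F × F × F) {j : ι} (hj : ∀ i, (C i).1 ≠ j) :
    ∃ u : ι × F × F × F, u.1 = j ∧ ∀ i, ¬ (lineGraphOfCliques c).IsMove (C i) u := by
  -- On the test points `(j, 0, t, 0)`, a cop outside the fibre fixes `t` by the first equation.
  obtain ⟨t, ht⟩ := exists_forall_not_of_card_lt (by simpa using hn)
    (fun i (t : F) => (lineGraphOfCliques c).IsMove (C i) (j, 0, t, 0)) (by
      intro i s t hs ht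
      rw [lineGraphOfCliques_isMove_iff (hj i)] at hs ht
      exact add_left_cancel (hs.1.trans ht.1.symm))
  exact ⟨_, rfl, ht⟩

theorem lineGraphOfCliques_not_copsWin [Fintype ι] [Fintype F] (hc : Function.Injective c) {n : ℕ}
    (hn : n < Fintype.card ι) : ¬ (lineGraphOfCliques c).CopsWin n := by
  have hnF : n < Fintype.card F := hn.trans_le (Fintype.card_le_of_injective c hc)
  have free : ∀ C : Fin n → ι × F × F × F, ∃ j, ∀ i, (C i).1 ≠ j := fun C =>
    exists_forall_not_of_card_lt (by simpa using hn) (fun i j => (C i).1 = j)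
      (fun _ _ _ hs ht => hs.symm.trans ht)
  apply not_copsWin_of_escape
  · intro C
    obtain ⟨j, hj⟩ := free C
    obtain ⟨u, -, hu⟩ := lineGraphOfCliques_exists_not_isMove (c := c) hnF C hj
    exact ⟨u, hu⟩
  · intro C v hv
    obtain ⟨j, hj⟩ := free C
    by_cases hvj : v.1 = j
    · obtain ⟨u, huj, hu⟩ := lineGraphOfCliques_exists_not_isMove (c := c) hnF C hj
      exact ⟨u, lineGraphOfCliques_isMove_of_fst_eq (hvj.trans huj.symm), hu⟩
    · obtain ⟨t, ht⟩ := exists_forall_not_of_card_lt (by simpa using hnF)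
        (fun i t => (lineGraphOfCliques c).IsMove (C i) (lineGraphOfCliquesNeighbor c v j t))
        (fun i _ _ => lineGraphOfCliques_eq_of_isMove_neighbor hc (hj i) (hv i))
      exact ⟨_, lineGraphOfCliques_isMove_neighbor hvj t, ht⟩

theorem lineGraphOfCliques_hasCliqueCover {k : ℕ} (c : Fin k → F) :
    (lineGraphOfCliques c).HasCliqueCover k := by
  refine ⟨fun i => {v | v.1 = i}, fun i u hu v hv huv => ?_, fun v => ⟨v.1, rfl⟩⟩
  exact ⟨huv, Or.inl (hu.trans hv.symm)⟩

theorem lineGraphOfCliques_exists_isIndepSet [Fintype ι] (c : ι → F) :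
    ∃ s : Finset (ι × F × F × F), (lineGraphOfCliques c).IsIndepSet s ∧
      s.card = Fintype.card ι := by
  -- The coordinate `1` makes the first adjacency equation read `0 = 1`.
  let e : ι ↪ ι × F × F × F := ⟨fun i => (i, 1, 0, 0), fun _ _ h => congrArg Prod.fst h⟩
  refine ⟨Finset.univ.map e, ?_, by simp⟩
  intro u hu v hv huv hadj
  simp only [Finset.coe_map, Finset.coe_univ, Set.image_univ, Set.mem_range] at hu hv
  obtain ⟨i, rfl⟩ := hu
  obtain ⟨j, rfl⟩ := hv
  obtain ⟨-, h | ⟨h, -⟩⟩ := hadj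
  · exact huv (congrArg e h)
  · change (0 : F) + 0 = 1 * 1 at h
    simp at h

end Construction

theorem eight_mul_pred_cube_le {k : ℕ} (hk : 2 ≤ k) :
    8 * ((k : ℝ) - 1) ^ 3 ≤ 11 * Real.log k ^ 2 * (k : ℝ) ^ 3 := by
  rcases hk.eq_or_lt with rfl | hk
  -- `k = 2` is separate because `log 2 < 1`.
  · have h := Real.log_two_gt_d9
    norm_num
    nlinarith
  · have hk' : (3 : ℝ) ≤ k := by exact_mod_cast hk
    have hlog : 1 ≤ Real.log k := by
      rw [Real.le_log_iff_exp_le (by linarith)]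
      exact (Real.exp_one_lt_d9.le.trans (by norm_num)).trans hk'
    have h₁ : ((k : ℝ) - 1) ^ 3 ≤ (k : ℝ) ^ 3 :=
      pow_le_pow_left₀ (by linarith) (by linarith) 3
    have h₂ : 1 ≤ Real.log k ^ 2 := one_le_pow₀ hlog
    have h₃ : 0 ≤ (k : ℝ) ^ 3 := by positivity
    nlinarith

end SimpleGraph

open SimpleGraph in
theorem theorem1 (k : ℕ) (hk : 1 ≤ k) :
    ∃ (V : Type) (_ : Fintype V) (G : SimpleGraph V),
      (Fintype.card V : ℝ) ≤ max 1 (11 * Real.log (k : ℝ) ^ 2 * (k : ℝ) ^ 4) ∧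
      G.Connected ∧
      G.copNumber = (k : ℕ∞) ∧
      G.cliqueCoverNumber = (k : ℕ∞) ∧
      G.indepNum = k := by
  rcases hk.eq_or_lt with rfl | hk
  · have hcover : (⊥ : SimpleGraph Unit).HasCliqueCover 1 :=
      ⟨fun _ => Set.univ, fun _ _ _ _ _ h => (h rfl).elim, fun _ => ⟨0, trivial⟩⟩
    have hindep : (⊥ : SimpleGraph Unit).IsIndepSet ({()} : Finset Unit) :=
      fun _ _ _ _ _ h => h
    refine ⟨Unit, inferInstance, ⊥, by simp, ⟨fun _ _ => Reachable.refl _⟩,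
      copNumber_eq_of_copsWin hcover.copsWin fun n hn => ?_,
      cliqueCoverNumber_eq_of_isIndepSet hcover hindep rfl,
      indepNum_eq_of_hasCliqueCover hcover hindep rfl⟩
    obtain rfl : n = 0 := by omega
    exact not_copsWin_of_escape (fun _ => ⟨(), fun i => i.elim0⟩)
      fun _ v _ => ⟨v, Or.inl rfl, fun i => i.elim0⟩
  -- Bertrand at `k - 1` gives `k ≤ p ≤ 2 (k - 1)`: enough for `c` to be injective, with `k p³ ≤ 8 k
  -- (k - 1)³` vertices.
  · obtain ⟨p, hp, hkp, hpk⟩ := Nat.exists_prime_lt_and_le_two_mul (k - 1) (by omega)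
    have : Fact p.Prime := ⟨hp⟩
    have : Nonempty (Fin k) := ⟨⟨0, by omega⟩⟩
    let c : Fin k → ZMod p := fun i => ((i : ℕ) : ZMod p)
    have hc : Function.Injective c := by
      intro i j hij
      have h := (ZMod.natCast_eq_natCast_iff' _ _ _).mp hij
      rw [Nat.mod_eq_of_lt (by omega), Nat.mod_eq_of_lt (by omega)] at h
      exact Fin.ext h
    obtain ⟨s, hs, hcard⟩ := lineGraphOfCliques_exists_isIndepSet c
    rw [Fintype.card_fin] at hcard
    have hcover := lineGraphOfCliques_hasCliqueCover c
    refine ⟨Fin k × ZMod p × ZMod p × ZMod p, inferInstance, lineGraphOfCliques c, ?_,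
      lineGraphOfCliques_connected,
      copNumber_eq_of_copsWin hcover.copsWin fun n hn =>
        lineGraphOfCliques_not_copsWin hc (by simpa using hn),
      cliqueCoverNumber_eq_of_isIndepSet hcover hs hcard,
      indepNum_eq_of_hasCliqueCover hcover hs hcard⟩
    refine le_max_of_le_right ?_
    have hpk' : (p : ℝ) ≤ 2 * ((k : ℝ) - 1) := by
      have h : (p : ℝ) ≤ ((2 * (k - 1) : ℕ) : ℝ) := by exact_mod_cast hpk
      rwa [Nat.cast_mul, Nat.cast_sub (by omega), Nat.cast_ofNat, Nat.cast_one] at h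
    simp only [Fintype.card_prod, Fintype.card_fin, ZMod.card, Nat.cast_mul]
    calc (k : ℝ) * (p * (p * p)) = k * (p : ℝ) ^ 3 := by ring
      _ ≤ k * (2 * ((k : ℝ) - 1)) ^ 3 := by gcongr
      _ = k * (8 * ((k : ℝ) - 1) ^ 3) := by ring
      _ ≤ k * (11 * Real.log k ^ 2 * (k : ℝ) ^ 3) :=
        mul_le_mul_of_nonneg_left (eight_mul_pred_cube_le hk) k.cast_nonneg
      _ = 11 * Real.log k ^ 2 * (k : ℝ) ^ 4 := by ring
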